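/- Fix a horizon $T\ge 1$, a finite set of actions $\mathcal A=\{1,\dots,K\}$ with mean values $\mu_a\in[0,1]$, and numbers $\sigma_{\mathrm{res},a}^2\ge 0$ that are known to the agent. Let $(\mathcal F_t)_{t\ge 0}$ be a filtration on a probability space. In round $t=1,\dots,T$ the agent selects an action $a_t$ and generates a square-integrable reflection prior $\hat\theta_t$, both $\mathcal F_{t-1}$-measurable, and then observes an $\mathcal F_t$-measurable evaluation score $X_t\in[0,1]$ (scores of different rounds may be dependent) such that, almost surely, $$\mathbb E[X_t\mid\mathcal F_{t-1}]=\mu_{a_t},\qquad \mathbb E\big[(X_t-\hat\theta_t)^2\mid\mathcal F_{t-1}\big]\le\sigma_{\mathrm{res},a_t}^2 .$$ Let $N_a(t)$ be the number of rounds $s\le t$ with $a_s=a$, let $\bar X_a(t)$ be the average of the scores of these rounds, and for $n\ge1$ put $$C_{n,a}(\delta)=\sqrt{\frac{2\sigma_{\mathrm{res},a}^2\ln(1/\delta)}{n}}+\frac{2\ln(1/\delta)}{3n}.$$ Suppose that in every round $t\le T$ the selected action maximizes (with arbitrary tie-breaking) the upper confidence index $\bar X_a(t-1)+C_{N_a(t-1),a}(T^{-2})$,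 where an action with $N_a(t-1)=0$ has index $+\infty$. Let $a^*$ be an action with $\mu_{a^*}=\max_a\mu_a$, put $\Delta_a=\mu_{a^*}-\mu_a$, and let $R_T=\sum_{a\ne a^*}\Delta_a\,\mathbb E[N_a(T)]$ be the cumulative regret. Then $$R_T\le\sum_{a:\,\Delta_a>0}\left(\frac{8\sigma_{\mathrm{res},a}^2\ln T}{\Delta_a}+\frac{16\ln T}{3}+2\Delta_a\right).$$ (If the optimal action is unique, the sum is over all $a\neq a^*$.) -/

import Mathlib

open MeasureTheory

/-- `pulls A t a ω`: the number of rounds `s ∈ {1, …, t}` in which action `a` was selected. -/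
def pulls {Ω : Type*} {K : ℕ} (A : ℕ → Ω → Fin K) (t : ℕ) (a : Fin K) (ω : Ω) : ℕ :=
  ((Finset.Icc 1 t).filter (fun s => A s ω = a)).card

/-- The empirical mean of the scores obtained from action `a` in the rounds `1, …, t`
(only meaningful if `a` has been selected at least once in these rounds). -/
noncomputable def empMean {Ω : Type*} {K : ℕ} (A : ℕ → Ω → Fin K) (X : ℕ → Ω → ℝ)
    (t : ℕ) (a : Fin K) (ω : Ω) : ℝ :=
  (∑ s ∈ (Finset.Icc 1 t).filter (fun s => A s ω = a), X s ω) / (pulls A t a ω : ℝ)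

/-- The confidence radius `√(2 v ln(1/δ) / n) + 2 ln(1/δ) / (3 n)` after `n ≥ 1` visits, for
residual variance `v` and confidence level `δ`. -/
noncomputable def confRadius (v δ : ℝ) (n : ℕ) : ℝ :=
  Real.sqrt (2 * v * Real.log (1 / δ) / n) + 2 * Real.log (1 / δ) / (3 * n)

/-- The upper confidence index of action `a` after `t` rounds, for horizon `T` and confidence
level `δ = T⁻²`; an action that has not been visited yet has index `+∞`. -/
noncomputable def ucbIndex {Ω : Type*} {K : ℕ} (T : ℕ) (σ : Fin K → ℝ) (A : ℕ → Ω → Fin K)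
    (X : ℕ → Ω → ℝ) (t : ℕ) (a : Fin K) (ω : Ω) : EReal :=
  if pulls A t a ω = 0 then ⊤
  else ((empMean A X t a ω + confRadius (σ a ^ 2) (1 / (T : ℝ) ^ 2) (pulls A t a ω) : ℝ) : EReal)

/-- The sequential evaluation model over `T` rounds. In round `t + 1` the agent selects the action
`A (t + 1)` and generates the reflection prior `θ (t + 1)` from the history `ℱ t`; then it observes
the evaluation score `X (t + 1) ∈ [0, 1]`. Scores may depend on the past: only the conditional mean
and the conditional residual second moment around `θ` are tied to the action. -/
structure IsReflectionBandit {Ω : Type*} [mΩ : MeasurableSpace Ω] (P : Measure Ω)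
    (ℱ : Filtration ℕ mΩ) {K : ℕ} (T : ℕ) (A : ℕ → Ω → Fin K) (X θ : ℕ → Ω → ℝ)
    (μ σ : Fin K → ℝ) : Prop where
  /-- the action is determined by the history -/
  action_predictable : ∀ t < T, Measurable[ℱ t] (A (t + 1))
  /-- the reflection prior is determined by the history -/
  reflection_predictable : ∀ t < T, Measurable[ℱ t] (θ (t + 1))
  /-- the reflection prior is square integrable -/
  reflection_memLp : ∀ t < T, MemLp (θ (t + 1)) 2 P
  /-- the score of a round belongs to the history after that round -/
  score_adapted : ∀ t < T, Measurable[ℱ (t + 1)] (X (t + 1))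
  /-- scores lie in the unit interval -/
  score_mem : ∀ t < T, ∀ᵐ ω ∂P, X (t + 1) ω ∈ Set.Icc (0 : ℝ) 1
  /-- so do the mean values of the actions, also of actions that are never selected -/
  mean_mem : ∀ a, μ a ∈ Set.Icc (0 : ℝ) 1
  /-- the conditional mean score is the mean value of the selected action -/
  score_mean : ∀ t < T, P[X (t + 1) | ℱ t] =ᵐ[P] fun ω => μ (A (t + 1) ω)
  /-- the conditional residual variance, when action `a` is selected, is at most `σ a ^ 2` -/
  residual_variance : ∀ t < T, ∀ᵐ ω ∂P,
    (P[fun ω' => (X (t + 1) ω' - θ (t + 1) ω') ^ 2 | ℱ t]) ω ≤ σ (A (t + 1) ω) ^ 2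

/-- In each of the rounds `1, …, T` the agent selects an action of maximal upper confidence index
(ties are broken arbitrarily). -/
def SelectsByUCB {Ω : Type*} [MeasurableSpace Ω] (P : Measure Ω) {K : ℕ} (T : ℕ)
    (σ : Fin K → ℝ) (A : ℕ → Ω → Fin K) (X : ℕ → Ω → ℝ) : Prop :=
  ∀ t < T, ∀ᵐ ω ∂P, ∀ b, ucbIndex T σ A X t b ω ≤ ucbIndex T σ A X t (A (t + 1) ω) ω

/-- The cumulative regret `∑_{a ≠ a⋆} Δ_a E[N_a(T)]` with `Δ_a = μ_{a⋆} - μ_a`. -/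
noncomputable def cumRegret {Ω : Type*} [MeasurableSpace Ω] (P : Measure Ω) {K : ℕ}
    (μ : Fin K → ℝ) (star : Fin K) (A : ℕ → Ω → Fin K) (T : ℕ) : ℝ :=
  ∑ a ∈ Finset.univ.erase star, (μ star - μ a) * ∫ ω, (pulls A T a ω : ℝ) ∂P

/-! Concentration is needed only for the optimal action, and only from below; a suboptimal action
`a` is handled by a pathwise inequality whose random term has mean zero. Let `S` be the sum of the
centred scores of `a`, `N` its number of selections and `Δ` its gap. If the index of `star` is at
least `μ star` whenever `a` is selected, the UCB rule forces `Δ N ≤ S + N · radius`. The square root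
in `N · radius` is absorbed by AM-GM into `Δ N / 2`, which leaves `Δ N ≤ 2 S + const`. Both sides
are frozen between selections of `a`, so the inequality holds at time `T` (`pulls_le_of_good`), and
integrating it removes `S` (`integral_centredSum`).

The index of `star` can fail only if, for some `n < T`, its first `n` scores deviate by more than
the Bernstein radius. The cap at `n` selections is a predictable condition, so Freedman's
supermartingale (`integral_exp_centredSum_le`) applies although scores are dependent and visit times
random. The residual variance enters because the conditional mean minimizes conditional mean square
error over predictable centres (`integral_mul_sub_sq_le`). Each `n` costs `T⁻²`, hence `1 / T` in
total, against a loss of at most `3 T` in the pathwise inequality. -/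

/-! ### Exponential estimates for Bernstein's inequality. -/

/-- The second-order Taylor bound for `exp` behind Bernstein's inequality. -/
theorem exp_le_one_add_add_sq {l z : ℝ} (hl : l < 3) (hz : |z| ≤ l) :
    Real.exp z ≤ 1 + z + z ^ 2 / (2 * (1 - l / 3)) := by
  have hl0 : 0 ≤ l := (abs_nonneg z).trans hz
  have h1 : HasSum (fun n : ℕ => z ^ n / (n.factorial : ℝ)) (Real.exp z) := by
    rw [Real.exp_eq_exp_ℝ]
    exact NormedSpace.expSeries_div_hasSum_exp z
  have h2 : HasSum (fun n : ℕ => z ^ (n + 2) / ((n + 2).factorial : ℝ)) (Real.exp z - (1 + z)) := by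
    have := (hasSum_nat_add_iff' 2).2 h1
    simpa [Finset.sum_range_succ] using this
  have h3 : HasSum (fun n : ℕ => z ^ 2 / 2 * (l / 3) ^ n) (z ^ 2 / 2 * (1 - l / 3)⁻¹) :=
    (hasSum_geometric_of_lt_one (by positivity) (by linarith)).mul_left _
  -- Beyond `2!`, each new factor of the factorial is at least 3, so the tail is dominated by a
  -- geometric series of ratio `l / 3`.
  have hfac : ∀ n : ℕ, (2 * 3 ^ n : ℝ) ≤ ((n + 2).factorial : ℝ) := by
    intro n
    induction n with
    | zero => norm_num [Nat.factorial]
    | succ k ih =>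
      have h : ((k + 1 + 2).factorial : ℝ) = (k + 3) * ((k + 2).factorial : ℝ) := by
        rw [show k + 1 + 2 = (k + 2) + 1 by ring, Nat.factorial_succ]; push_cast; ring
      rw [h, pow_succ]
      have hk : (0 : ℝ) ≤ k := Nat.cast_nonneg k
      have h3 : (0 : ℝ) ≤ 3 ^ k := by positivity
      nlinarith
  have h4 := hasSum_le (fun n => ?_) h2 h3
  · have h5 : z ^ 2 / 2 * (1 - l / 3)⁻¹ = z ^ 2 / (2 * (1 - l / 3)) := by
      rw [div_mul_eq_div_div, div_eq_mul_inv (z ^ 2 / 2)]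
    linarith
  · calc z ^ (n + 2) / ((n + 2).factorial : ℝ) ≤ |z| ^ (n + 2) / ((n + 2).factorial : ℝ) := by
          refine div_le_div_of_nonneg_right ?_ (by positivity)
          rw [← abs_pow]
          exact le_abs_self _
      _ ≤ |z| ^ (n + 2) / (2 * 3 ^ n) := by
          gcongr
          exact hfac n
      _ = z ^ 2 / 2 * (|z| / 3) ^ n := by
          rw [pow_add, sq_abs, div_pow]
          field_simp
      _ ≤ z ^ 2 / 2 * (l / 3) ^ n := by gcongr

/-- An exponent for which the Bernstein moment bound yields the tail level `exp (-L)` at the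
deviation `√(2 V L) + 2 L / 3`. -/
theorem exists_bernstein_exponent {V L : ℝ} (hV : 0 ≤ V) (hL : 0 < L) :
    ∃ l : ℝ, 0 ≤ l ∧ l ≤ 3 / 2 ∧
      l ^ 2 / (2 * (1 - l / 3)) * V - l * (Real.sqrt (2 * V * L) + 2 * L / 3) ≤ -L := by
  obtain ⟨w, hw0, hw⟩ : ∃ w : ℝ, 0 ≤ w ∧ V = 2 * L * w ^ 2 :=
    ⟨Real.sqrt (V / (2 * L)), Real.sqrt_nonneg _, by
      rw [Real.sq_sqrt (by positivity)]; field_simp⟩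
  have hs : Real.sqrt (2 * V * L) = 2 * L * w := by
    rw [hw, show 2 * (2 * L * w ^ 2) * L = (2 * L * w) ^ 2 by ring]
    exact Real.sqrt_sq (by positivity)
  have h23 : 0 < w + 2 / 3 := by positivity
  have h13 : 0 < w + 1 / 3 := by positivity
  -- The optimal exponent is `1 / (w + 1 / 3)`, which would give the deviation `√(2 V L) + L / 3`
  -- but reaches the pole `l = 3` at `w = 0`. The larger term `2 L / 3` pays for the shift to `w + 2
  -- / 3`, which keeps `l ≤ 3 / 2` and covers `V = 0`.
  refine ⟨1 / (w + 2 / 3), by positivity, ?_, ?_⟩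
  · rw [div_le_iff₀ h23]; linarith
  · have e : 1 - 1 / (w + 2 / 3) / 3 = (w + 1 / 3) / (w + 2 / 3) := by
      field_simp; ring
    rw [hs, e, hw]
    have e2 : (1 / (w + 2 / 3)) ^ 2 / (2 * ((w + 1 / 3) / (w + 2 / 3))) * (2 * L * w ^ 2)
        - 1 / (w + 2 / 3) * (2 * L * w + 2 * L / 3)
        = -(L * ((w ^ 2 + 4 * w / 3 + 2 / 9) / ((w + 2 / 3) * (w + 1 / 3)))) := by
      field_simp; ring
    rw [e2]
    have h : 1 ≤ (w ^ 2 + 4 * w / 3 + 2 / 9) / ((w + 2 / 3) * (w + 1 / 3)) := by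
      rw [le_div_iff₀ (by positivity)]; nlinarith
    nlinarith

/-! ### Weighted conditional first and second moments. -/

section CondExp

variable {Ω : Type*} {m mΩ : MeasurableSpace Ω} {P : Measure Ω} [IsProbabilityMeasure P]

theorem integral_mul_condExp_of_stronglyMeasurable (hm : m ≤ mΩ) {W Y : Ω → ℝ}
    (hW : StronglyMeasurable[m] W) (hWY : Integrable (W * Y) P) (hY : Integrable Y P) :
    ∫ ω, W ω * Y ω ∂P = ∫ ω, W ω * (P[Y | m]) ω ∂P := by
  have h := condExp_mul_of_stronglyMeasurable_left hW hWY hY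
  rw [show (∫ ω, W ω * Y ω ∂P) = ∫ ω, (W * Y) ω ∂P from rfl, ← integral_condExp hm]
  exact integral_congr_ae h

variable {X θ W : Ω → ℝ} {c v C : ℝ}

/-- A weight from the past that only sees one conditional mean integrates the centred score
to zero. -/
theorem integral_mul_sub_eq_zero (hm : m ≤ mΩ) (hX : Measurable X)
    (hX01 : ∀ᵐ ω ∂P, X ω ∈ Set.Icc (0 : ℝ) 1)
    (hW : StronglyMeasurable[m] W) (hWi : Integrable W P)
    (hmean : ∀ᵐ ω ∂P, W ω ≠ 0 → (P[X | m]) ω = c) :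
    ∫ ω, W ω * (X ω - c) ∂P = 0 := by
  have hXn : ∀ᵐ ω ∂P, ‖X ω‖ ≤ 1 := by
    filter_upwards [hX01] with ω h
    rw [Real.norm_eq_abs, abs_le]
    exact ⟨by linarith [h.1], h.2⟩
  have hXi : Integrable X P := Integrable.of_bound hX.aestronglyMeasurable 1 hXn
  have hWX : Integrable (fun ω => W ω * X ω) P := hWi.mul_bdd (c := 1) hX.aestronglyMeasurable hXn
  have h1 : ∫ ω, W ω * X ω ∂P = ∫ ω, W ω * c ∂P := by
    rw [integral_mul_condExp_of_stronglyMeasurable hm hW hWX hXi]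
    refine integral_congr_ae ?_
    filter_upwards [hmean] with ω h
    by_cases h0 : W ω = 0
    · simp [h0]
    · simp [h h0]
  simp_rw [mul_sub]
  rw [integral_sub hWX (hWi.mul_const c), h1, sub_self]

/-- Under such a weight the second moment around the conditional mean is at most any bound for
the conditional second moment around a predictable point. -/
theorem integral_mul_sub_sq_le (hm : m ≤ mΩ) (hX : Measurable X)
    (hX01 : ∀ᵐ ω ∂P, X ω ∈ Set.Icc (0 : ℝ) 1)
    (hθ : Measurable[m] θ) (hθ2 : MemLp θ 2 P)
    (hW : StronglyMeasurable[m] W) (hW0 : ∀ ω, 0 ≤ W ω) (hWC : ∀ᵐ ω ∂P, W ω ≤ C)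
    (hmean : ∀ᵐ ω ∂P, W ω ≠ 0 → (P[X | m]) ω = c)
    (hvar : ∀ᵐ ω ∂P, W ω ≠ 0 → (P[fun ω' => (X ω' - θ ω') ^ 2 | m]) ω ≤ v) :
    ∫ ω, W ω * (X ω - c) ^ 2 ∂P ≤ v * ∫ ω, W ω ∂P := by
  have hXn : ∀ᵐ ω ∂P, ‖X ω‖ ≤ 1 := by
    filter_upwards [hX01] with ω h
    rw [Real.norm_eq_abs, abs_le]
    exact ⟨by linarith [h.1], h.2⟩
  have hWm : AEStronglyMeasurable W P := (hW.mono hm).aestronglyMeasurable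
  have hWn : ∀ᵐ ω ∂P, ‖W ω‖ ≤ C := by
    filter_upwards [hWC] with ω h
    rwa [Real.norm_eq_abs, abs_of_nonneg (hW0 ω)]
  have hWi : Integrable W P := Integrable.of_bound hWm C hWn
  have hX2 : MemLp X 2 P := MemLp.of_bound hX.aestronglyMeasurable 1 hXn
  have hXθ : MemLp (fun ω => X ω - θ ω) 2 P := hX2.sub hθ2
  have hθc : MemLp (fun ω => θ ω - c) 2 P := hθ2.sub (memLp_const c)
  have hXc : MemLp (fun ω => X ω - c) 2 P := hX2.sub (memLp_const c)
  have hi1 : Integrable (fun ω => W ω * (X ω - θ ω) ^ 2) P :=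
    hXθ.integrable_sq.bdd_mul hWm hWn
  have hi2 : Integrable (fun ω => W ω * (θ ω - c)) P :=
    (hθc.integrable (by norm_num)).bdd_mul hWm hWn
  have hi3 : Integrable (fun ω => W ω * (X ω - c) ^ 2) P :=
    hXc.integrable_sq.bdd_mul hWm hWn
  have hi4 : Integrable (fun ω => W ω * (θ ω - c) * (X ω - c)) P := by
    refine hi2.mul_bdd (c := 1 + |c|) hXc.aestronglyMeasurable ?_
    filter_upwards [hXn] with ω h
    exact (norm_sub_le _ _).trans (by rw [Real.norm_eq_abs c]; linarith)
  -- Here `(X - c)² = (X - θ)² + 2 (θ - c)(X - c) - (θ - c)²`. The cross term integrates to zero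
  -- because `W (θ - c)` is itself a weight from the past, and the last square is dropped.
  have hcross : ∫ ω, W ω * (θ ω - c) * (X ω - c) ∂P = 0 := by
    refine integral_mul_sub_eq_zero hm hX hX01
      (hW.mul (hθ.stronglyMeasurable.sub stronglyMeasurable_const)) hi2 ?_
    filter_upwards [hmean] with ω h h0
    exact h (left_ne_zero_of_mul h0)
  have hres : ∫ ω, W ω * (X ω - θ ω) ^ 2 ∂P ≤ v * ∫ ω, W ω ∂P := by
    rw [integral_mul_condExp_of_stronglyMeasurable hm hW hi1 hXθ.integrable_sq,
      ← integral_const_mul]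
    refine integral_mono_ae (integrable_condExp.bdd_mul hWm hWn) (hWi.const_mul v) ?_
    filter_upwards [hvar] with ω h
    by_cases h0 : W ω = 0
    · simp [h0]
    · simpa [mul_comm v] using mul_le_mul_of_nonneg_left (h h0) (hW0 ω)
  calc ∫ ω, W ω * (X ω - c) ^ 2 ∂P
      ≤ ∫ ω, (W ω * (X ω - θ ω) ^ 2 + 2 * (W ω * (θ ω - c) * (X ω - c))) ∂P := by
        refine integral_mono hi3 (hi1.add (hi4.const_mul 2)) fun ω => ?_
        have := mul_nonneg (hW0 ω) (sq_nonneg (θ ω - c))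
        dsimp only [Pi.add_apply]
        nlinarith
    _ = ∫ ω, W ω * (X ω - θ ω) ^ 2 ∂P := by
        rw [integral_add hi1 (hi4.const_mul 2), integral_const_mul, hcross]; ring
    _ ≤ v * ∫ ω, W ω ∂P := hres

end CondExp

/-! ### Martingale and Freedman supermartingale over predictable sets of rounds. -/

/-- The sum of the centred scores of the rounds `s + 1 ≤ t` with `ω ∈ G s`. -/
noncomputable def centredSum {Ω : Type*} (G : ℕ → Set Ω) (X : ℕ → Ω → ℝ) (c : ℝ) (t : ℕ)
    (ω : Ω) : ℝ :=
  ∑ s ∈ Finset.range t, (G s).indicator (fun ω' => X (s + 1) ω' - c) ω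

/-- The number of rounds `s + 1 ≤ t` with `ω ∈ G s`. -/
noncomputable def roundCount {Ω : Type*} (G : ℕ → Set Ω) (t : ℕ) (ω : Ω) : ℝ :=
  ∑ s ∈ Finset.range t, (G s).indicator (fun _ => (1 : ℝ)) ω

theorem centredSum_succ {Ω : Type*} (G : ℕ → Set Ω) (X : ℕ → Ω → ℝ) (c : ℝ) (t : ℕ) (ω : Ω) :
    centredSum G X c (t + 1) ω
      = centredSum G X c t ω + (G t).indicator (fun ω' => X (t + 1) ω' - c) ω :=
  Finset.sum_range_succ _ _

theorem roundCount_succ {Ω : Type*} (G : ℕ → Set Ω) (t : ℕ) (ω : Ω) :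
    roundCount G (t + 1) ω = roundCount G t ω + (G t).indicator (fun _ => (1 : ℝ)) ω :=
  Finset.sum_range_succ _ _

section Martingale

variable {Ω : Type*} [mΩ : MeasurableSpace Ω] {P : Measure Ω}
  {ℱ : Filtration ℕ mΩ} {K T : ℕ} {A : ℕ → Ω → Fin K} {X θ : ℕ → Ω → ℝ} {μ σ : Fin K → ℝ}
  {G : ℕ → Set Ω} {a : Fin K}

namespace IsReflectionBandit

theorem measurable_score (h : IsReflectionBandit P ℱ T A X θ μ σ) {t : ℕ} (ht : t < T) :
    Measurable (X (t + 1)) :=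
  (h.score_adapted t ht).mono (ℱ.le _) le_rfl

theorem ae_abs_score_sub_le (h : IsReflectionBandit P ℱ T A X θ μ σ) (a : Fin K) :
    ∀ᵐ ω ∂P, ∀ t < T, |X (t + 1) ω - μ a| ≤ 1 := by
  rw [ae_all_iff]
  intro t
  by_cases ht : t < T
  · filter_upwards [h.score_mem t ht] with ω hω _
    have := h.mean_mem a
    rw [abs_le]
    constructor <;> linarith [hω.1, hω.2, this.1, this.2]
  · exact Filter.Eventually.of_forall fun ω h' => absurd h' ht

theorem measurable_centredSum (h : IsReflectionBandit P ℱ T A X θ μ σ)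
    (hG : ∀ t < T, MeasurableSet[ℱ t] (G t)) (c : ℝ) {t : ℕ} (ht : t ≤ T) :
    Measurable[ℱ t] (centredSum G X c t) := by
  refine Finset.measurable_fun_sum _ fun s hs => ?_
  have hst : s < t := Finset.mem_range.1 hs
  refine Measurable.indicator ?_ (ℱ.mono hst.le _ (hG s (by omega)))
  exact (((h.score_adapted s (by omega)).mono (ℱ.mono hst) le_rfl)).sub_const c

theorem measurable_roundCount (hG : ∀ t < T, MeasurableSet[ℱ t] (G t)) {t : ℕ} (ht : t ≤ T) :
    Measurable[ℱ t] (roundCount G t) := by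
  refine Finset.measurable_fun_sum _ fun s hs => ?_
  have hst : s < t := Finset.mem_range.1 hs
  exact Measurable.indicator measurable_const (ℱ.mono hst.le _ (hG s (by omega)))

theorem ae_abs_centredSum_le (h : IsReflectionBandit P ℱ T A X θ μ σ) (a : Fin K) :
    ∀ᵐ ω ∂P, ∀ t ≤ T, |centredSum G X (μ a) t ω| ≤ t := by
  filter_upwards [h.ae_abs_score_sub_le a] with ω hω t ht
  calc |centredSum G X (μ a) t ω|
      ≤ ∑ s ∈ Finset.range t, |(G s).indicator (fun ω' => X (s + 1) ω' - μ a) ω| :=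
        Finset.abs_sum_le_sum_abs _ _
    _ ≤ ∑ s ∈ Finset.range t, (1 : ℝ) := by
        refine Finset.sum_le_sum fun s hs => ?_
        have := hω s (by have := Finset.mem_range.1 hs; omega)
        by_cases hs : ω ∈ G s
        · simpa [hs] using this
        · simp [hs]
    _ = t := by simp

theorem ae_condMean_eq (h : IsReflectionBandit P ℱ T A X θ μ σ)
    {t : ℕ} (ht : t < T) (hGA : ∀ ω ∈ G t, A (t + 1) ω = a) :
    ∀ᵐ ω ∂P, ω ∈ G t → (P[X (t + 1) | ℱ t]) ω = μ a := by
  filter_upwards [h.score_mean t ht] with ω hω hG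
  rw [hω, hGA ω hG]

variable [IsProbabilityMeasure P]

theorem integrable_centredSum (h : IsReflectionBandit P ℱ T A X θ μ σ)
    (hG : ∀ t < T, MeasurableSet[ℱ t] (G t)) (a : Fin K) {t : ℕ} (ht : t ≤ T) :
    Integrable (centredSum G X (μ a) t) P := by
  refine Integrable.of_bound
    ((h.measurable_centredSum hG _ ht).mono (ℱ.le _) le_rfl).aestronglyMeasurable t ?_
  filter_upwards [h.ae_abs_centredSum_le (G := G) a] with ω hω using hω t ht

/-- Each increment is centred given the past, as membership in `G t` is decided before the score.
Applied to all selections of a suboptimal action, this replaces a tail bound for that action. -/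
theorem integral_centredSum (h : IsReflectionBandit P ℱ T A X θ μ σ)
    (hG : ∀ t < T, MeasurableSet[ℱ t] (G t)) (hGA : ∀ t < T, ∀ ω ∈ G t, A (t + 1) ω = a)
    {t : ℕ} (ht : t ≤ T) :
    ∫ ω, centredSum G X (μ a) t ω ∂P = 0 := by
  have hterm : ∀ s < T, ∫ ω, (G s).indicator (fun ω' => X (s + 1) ω' - μ a) ω ∂P = 0 := by
    intro s hs
    have hWm : StronglyMeasurable[ℱ s] ((G s).indicator fun _ => (1 : ℝ)) :=
      stronglyMeasurable_const.indicator (hG s hs)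
    have := integral_mul_sub_eq_zero (ℱ.le s) (h.measurable_score hs) (h.score_mem s hs) hWm
      ((integrable_const (1 : ℝ)).indicator (ℱ.le s _ (hG s hs))) (c := μ a) (by
        filter_upwards [h.ae_condMean_eq hs (hGA s hs)] with ω hω h0
        exact hω (Set.mem_of_indicator_ne_zero h0))
    rw [← this]
    congr with ω
    by_cases hω : ω ∈ G s <;> simp [hω]
  induction t with
  | zero => simp [centredSum]
  | succ t ih =>
    have hi := h.integrable_centredSum hG a (t := t) (by omega)
    have hi' := h.integrable_centredSum hG a ht
    have e : ∀ ω, (G t).indicator (fun ω' => X (t + 1) ω' - μ a) ω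
        = centredSum G X (μ a) (t + 1) ω - centredSum G X (μ a) t ω := fun ω => by
      rw [centredSum_succ]; ring
    have := hterm t (by omega)
    simp_rw [e] at this
    rw [integral_sub hi' hi, ih (by omega)] at this
    linarith

/-- Freedman's exponential supermartingale for the scores of one action. -/
theorem integral_exp_centredSum_le (h : IsReflectionBandit P ℱ T A X θ μ σ)
    (hG : ∀ t < T, MeasurableSet[ℱ t] (G t)) (hGA : ∀ t < T, ∀ ω ∈ G t, A (t + 1) ω = a)
    {l : ℝ} (hl0 : 0 ≤ l) (hl3 : l < 3) {t : ℕ} (ht : t ≤ T) :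
    Integrable (fun ω => Real.exp (-l * centredSum G X (μ a) t ω
        - l ^ 2 / (2 * (1 - l / 3)) * σ a ^ 2 * roundCount G t ω)) P ∧
      ∫ ω, Real.exp (-l * centredSum G X (μ a) t ω
        - l ^ 2 / (2 * (1 - l / 3)) * σ a ^ 2 * roundCount G t ω) ∂P ≤ 1 := by
  set c := l ^ 2 / (2 * (1 - l / 3)) with hc
  have hc0 : 0 ≤ c := div_nonneg (sq_nonneg l) (by linarith)
  set v := σ a ^ 2 with hv
  have hv0 : 0 ≤ v := sq_nonneg _
  set Z : ℕ → Ω → ℝ := fun t ω =>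
    Real.exp (-l * centredSum G X (μ a) t ω - c * v * roundCount G t ω) with hZ
  have hZm : ∀ t ≤ T, Measurable[ℱ t] (Z t) := fun t ht =>
    Real.measurable_exp.comp (((h.measurable_centredSum hG _ ht).const_mul _).sub
      ((measurable_roundCount hG ht).const_mul _))
  have hcount : ∀ t ω, 0 ≤ roundCount G t ω := fun t ω =>
    Finset.sum_nonneg fun s _ => Set.indicator_nonneg (fun _ _ => zero_le_one) _
  have hZb : ∀ᵐ ω ∂P, ∀ t ≤ T, Z t ω ≤ Real.exp (l * t) := by
    filter_upwards [h.ae_abs_centredSum_le (G := G) a] with ω hω t ht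
    refine Real.exp_le_exp.2 ?_
    have h1 := mul_nonneg (mul_nonneg hc0 hv0) (hcount t ω)
    have h2 := mul_le_mul_of_nonneg_left (neg_le_of_abs_le (hω t ht)) hl0
    linarith
  have hZi : ∀ t ≤ T, Integrable (Z t) P := fun t ht =>
    Integrable.of_bound ((hZm t ht).mono (ℱ.le t) le_rfl).aestronglyMeasurable
      (Real.exp (l * t)) (by
        filter_upwards [hZb] with ω hω
        rw [Real.norm_eq_abs, abs_of_pos (Real.exp_pos _)]
        exact hω t ht)
  refine ⟨hZi t ht, ?_⟩
  change ∫ ω, Z t ω ∂P ≤ 1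
  induction t with
  | zero => simp [hZ, centredSum, roundCount]
  | succ t ih =>
    have htT : t < T := ht
    refine le_trans ?_ (ih htT.le)
    have hGm : MeasurableSet (G t) := ℱ.le t _ (hG t htT)
    set W : Ω → ℝ := (G t).indicator (Z t) with hW
    have hWm : StronglyMeasurable[ℱ t] W :=
      (hZm t htT.le).stronglyMeasurable.indicator (hG t htT)
    have hWi : Integrable W P := (hZi t htT.le).indicator hGm
    have hW0 : ∀ ω, 0 ≤ W ω := fun ω =>
      Set.indicator_nonneg (fun _ _ => (Real.exp_pos _).le) _
    have hWC : ∀ᵐ ω ∂P, W ω ≤ Real.exp (l * t) := by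
      filter_upwards [hZb] with ω hω
      exact (Set.indicator_le_self' (fun _ _ => (Real.exp_pos _).le) ω).trans (hω t htT.le)
    have hmean : ∀ᵐ ω ∂P, W ω ≠ 0 → (P[X (t + 1) | ℱ t]) ω = μ a := by
      filter_upwards [h.ae_condMean_eq htT (hGA t htT)] with ω hω h0
      exact hω (Set.mem_of_indicator_ne_zero h0)
    have hvar : ∀ᵐ ω ∂P, W ω ≠ 0 →
        (P[fun ω' => (X (t + 1) ω' - θ (t + 1) ω') ^ 2 | ℱ t]) ω ≤ v := by
      filter_upwards [h.residual_variance t htT] with ω hω h0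
      rwa [hGA t htT ω (Set.mem_of_indicator_ne_zero h0)] at hω
    have hfirst := integral_mul_sub_eq_zero (ℱ.le t) (h.measurable_score htT)
      (h.score_mem t htT) hWm hWi hmean
    have hsecond := integral_mul_sub_sq_le (ℱ.le t) (h.measurable_score htT)
      (h.score_mem t htT) (h.reflection_predictable t htT) (h.reflection_memLp t htT)
      hWm hW0 hWC hmean hvar
    have hY : ∀ᵐ ω ∂P, |X (t + 1) ω - μ a| ≤ 1 := by
      filter_upwards [h.ae_abs_score_sub_le a] with ω hω using hω t htT
    have hYm : Measurable fun ω => X (t + 1) ω - μ a := (h.measurable_score htT).sub_const _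
    have hi1 : Integrable (fun ω => W ω * (X (t + 1) ω - μ a)) P :=
      hWi.mul_bdd (c := 1) hYm.aestronglyMeasurable hY
    have hi2 : Integrable (fun ω => W ω * (X (t + 1) ω - μ a) ^ 2) P :=
      hWi.mul_bdd (c := 1) (hYm.pow_const 2).aestronglyMeasurable (by
        filter_upwards [hY] with ω hω
        rw [norm_pow]
        exact pow_le_one₀ (norm_nonneg _) hω)
    -- Off `G t` nothing changes. On `G t` the new factor is `exp (-c v) exp (-l Y)` with `Y` the
    -- centred score, and the Taylor bound gives `exp (-l Y) ≤ 1 - l Y + c Y²`.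
    have hpt : ∀ᵐ ω ∂P, Z (t + 1) ω ≤ (Z t ω - W ω) + Real.exp (-(c * v)) *
        (W ω - l * (W ω * (X (t + 1) ω - μ a)) + c * (W ω * (X (t + 1) ω - μ a) ^ 2)) := by
      filter_upwards [hY] with ω hω
      by_cases hm : ω ∈ G t
      · have e : Z (t + 1) ω = Z t ω * (Real.exp (-(c * v)) *
            Real.exp (-l * (X (t + 1) ω - μ a))) := by
          simp only [hZ, centredSum_succ, roundCount_succ, Set.indicator_of_mem hm]
          rw [← Real.exp_add, ← Real.exp_add]
          ring_nf
        have hWe : W ω = Z t ω := Set.indicator_of_mem hm _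
        have hb := exp_le_one_add_add_sq hl3 (z := -l * (X (t + 1) ω - μ a)) (by
          rw [abs_mul, abs_neg, abs_of_nonneg hl0]
          exact mul_le_of_le_one_right hl0 hω)
        have e2 : (-l * (X (t + 1) ω - μ a)) ^ 2 / (2 * (1 - l / 3))
            = c * (X (t + 1) ω - μ a) ^ 2 := by rw [hc]; ring
        rw [e2] at hb
        rw [e, hWe]
        have := mul_le_mul_of_nonneg_left hb
          (mul_pos (Real.exp_pos (-l * centredSum G X (μ a) t ω - c * v * roundCount G t ω))
            (Real.exp_pos (-(c * v)))).le
        change Z t ω * Real.exp (-(c * v)) * _ ≤ Z t ω * Real.exp (-(c * v)) * _ at this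
        linarith
      · have hWe : W ω = 0 := Set.indicator_of_notMem hm _
        simp [hZ, centredSum_succ, roundCount_succ, hm, hWe]
    -- After integration the linear term vanishes and the square contributes at most `c v`; the
    -- compensator `exp (-c v)` cancels the factor `1 + c v`.
    have hsmall : Real.exp (-(c * v)) * (1 + c * v) ≤ 1 := by
      rw [Real.exp_neg, inv_mul_le_one₀ (Real.exp_pos _)]
      linarith [Real.add_one_le_exp (c * v)]
    have hiT : Integrable (fun ω => W ω - l * (W ω * (X (t + 1) ω - μ a))) P :=
      hWi.sub (hi1.const_mul l)
    have hiT' : Integrable (fun ω => W ω - l * (W ω * (X (t + 1) ω - μ a))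
        + c * (W ω * (X (t + 1) ω - μ a) ^ 2)) P := hiT.add (hi2.const_mul c)
    have hiZW : Integrable (fun ω => Z t ω - W ω) P := (hZi t htT.le).sub hWi
    have hWint : 0 ≤ ∫ ω, W ω ∂P := integral_nonneg hW0
    calc ∫ ω, Z (t + 1) ω ∂P
        ≤ ∫ ω, ((Z t ω - W ω) + Real.exp (-(c * v)) * (W ω - l * (W ω * (X (t + 1) ω - μ a))
            + c * (W ω * (X (t + 1) ω - μ a) ^ 2))) ∂P :=
          integral_mono_ae (hZi _ ht) (hiZW.add (hiT'.const_mul _)) hpt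
      _ = (∫ ω, Z t ω ∂P - ∫ ω, W ω ∂P) + Real.exp (-(c * v)) * (∫ ω, W ω ∂P
            + c * ∫ ω, W ω * (X (t + 1) ω - μ a) ^ 2 ∂P) := by
          rw [integral_add hiZW (hiT'.const_mul _), integral_sub (hZi t htT.le) hWi,
            integral_const_mul, integral_add hiT (hi2.const_mul c),
            integral_sub hWi (hi1.const_mul l), integral_const_mul, integral_const_mul, hfirst]
          ring
      _ ≤ (∫ ω, Z t ω ∂P - ∫ ω, W ω ∂P) + Real.exp (-(c * v)) * (∫ ω, W ω ∂P
            + c * (v * ∫ ω, W ω ∂P)) := by gcongr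
      _ ≤ ∫ ω, Z t ω ∂P := by
          have := mul_le_mul_of_nonneg_right hsmall hWint
          linarith

/-- The Bernstein tail of the scores of at most `n` rounds of one action, in exponential form. -/
theorem integral_exp_deviation_le (h : IsReflectionBandit P ℱ T A X θ μ σ)
    (hG : ∀ t < T, MeasurableSet[ℱ t] (G t)) (hGA : ∀ t < T, ∀ ω ∈ G t, A (t + 1) ω = a)
    {L : ℝ} (hL : 0 < L) {n : ℕ} (hn : ∀ ω, roundCount G T ω ≤ n) :
    ∃ l : ℝ, 0 ≤ l ∧
      Integrable (fun ω => Real.exp (-l * (centredSum G X (μ a) T ω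
        + (Real.sqrt (2 * (σ a ^ 2 * n) * L) + 2 * L / 3)))) P ∧
      ∫ ω, Real.exp (-l * (centredSum G X (μ a) T ω
        + (Real.sqrt (2 * (σ a ^ 2 * n) * L) + 2 * L / 3))) ∂P ≤ Real.exp (-L) := by
  obtain ⟨l, hl0, hl, hexp⟩ := exists_bernstein_exponent
    (mul_nonneg (sq_nonneg (σ a)) (Nat.cast_nonneg (α := ℝ) n)) hL
  set x := Real.sqrt (2 * (σ a ^ 2 * n) * L) + 2 * L / 3
  obtain ⟨hi, hle⟩ := h.integral_exp_centredSum_le hG hGA hl0 (by linarith) le_rfl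
  set c := l ^ 2 / (2 * (1 - l / 3))
  have hc0 : 0 ≤ c := div_nonneg (sq_nonneg l) (by linarith)
  have hpt : ∀ ω, Real.exp (-l * (centredSum G X (μ a) T ω + x)) ≤ Real.exp (-L) *
      Real.exp (-l * centredSum G X (μ a) T ω - c * σ a ^ 2 * roundCount G T ω) := by
    intro ω
    rw [← Real.exp_add]
    refine Real.exp_le_exp.2 ?_
    -- The deterministic bound `n` on the number of rounds turns the random variance penalty into
    -- the constant `V = σ a ^ 2 * n`.
    have := mul_le_mul_of_nonneg_left (hn ω) (mul_nonneg hc0 (sq_nonneg (σ a)))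
    linarith
  have hi' : Integrable (fun ω => Real.exp (-l * (centredSum G X (μ a) T ω + x))) P := by
    refine (hi.const_mul (Real.exp (-L))).mono' ?_ (Filter.Eventually.of_forall fun ω => ?_)
    · exact (Real.measurable_exp.comp ((((h.measurable_centredSum hG _ le_rfl).mono
        (ℱ.le _) le_rfl).add_const x).const_mul _)).aestronglyMeasurable
    · rw [Real.norm_eq_abs, abs_of_pos (Real.exp_pos _)]
      exact hpt ω
  refine ⟨l, hl0, hi', ?_⟩
  calc _ ≤ ∫ ω, Real.exp (-L) *
        Real.exp (-l * centredSum G X (μ a) T ω - c * σ a ^ 2 * roundCount G T ω) ∂P :=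
        integral_mono hi' (hi.const_mul _) hpt
    _ ≤ Real.exp (-L) := by
        rw [integral_const_mul]
        exact mul_le_of_le_one_right (Real.exp_pos _).le hle

end IsReflectionBandit

end Martingale

/-! ### Pathwise analysis of the UCB rule. -/

/-- The event, indexed by `s`, that action `a` is selected in round `s + 1`. -/
def selectedSet {Ω : Type*} {K : ℕ} (A : ℕ → Ω → Fin K) (a : Fin K) (s : ℕ) : Set Ω :=
  {ω | A (s + 1) ω = a}

/-- The event that action `a` is selected in round `s + 1` for one of its first `n` times. -/
def cappedSet {Ω : Type*} {K : ℕ} (A : ℕ → Ω → Fin K) (a : Fin K) (n s : ℕ) : Set Ω :=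
  {ω | A (s + 1) ω = a ∧ pulls A s a ω < n}

section Pathwise

variable {Ω : Type*} {K : ℕ} {A : ℕ → Ω → Fin K} {X : ℕ → Ω → ℝ} {a : Fin K} {ω : Ω} {t n : ℕ}

theorem pulls_zero : pulls A 0 a ω = 0 := by simp [pulls]

theorem pulls_succ_of_eq (h : A (t + 1) ω = a) : pulls A (t + 1) a ω = pulls A t a ω + 1 := by
  unfold pulls
  rw [← Finset.insert_Icc_right_eq_Icc_add_one (by omega), Finset.filter_insert, if_pos h,
    Finset.card_insert_of_notMem (by simp)]

theorem pulls_succ_of_ne (h : A (t + 1) ω ≠ a) : pulls A (t + 1) a ω = pulls A t a ω := by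
  unfold pulls
  rw [← Finset.insert_Icc_right_eq_Icc_add_one (by omega), Finset.filter_insert, if_neg h]

theorem pulls_le : pulls A t a ω ≤ t := by
  simpa [pulls] using Finset.card_filter_le (Finset.Icc 1 t) fun s => A s ω = a

theorem sum_filter_eq_centredSum (c : ℝ) :
    ∑ s ∈ (Finset.Icc 1 t).filter (fun s => A s ω = a), X s ω
      = centredSum (selectedSet A a) X c t ω + pulls A t a ω * c := by
  induction t with
  | zero => simp [centredSum, pulls]
  | succ t ih =>
    rw [← Finset.insert_Icc_right_eq_Icc_add_one (by omega), Finset.filter_insert,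
      centredSum_succ]
    by_cases h : A (t + 1) ω = a
    · have hm : ω ∈ selectedSet A a t := h
      rw [if_pos h, Finset.sum_insert (by simp), ih, pulls_succ_of_eq h,
        Set.indicator_of_mem hm]
      push_cast; ring
    · have hm : ω ∉ selectedSet A a t := h
      rw [if_neg h, ih, pulls_succ_of_ne h, Set.indicator_of_notMem hm, add_zero]

theorem empMean_mul_pulls (c : ℝ) (h : pulls A t a ω ≠ 0) :
    empMean A X t a ω * pulls A t a ω
      = centredSum (selectedSet A a) X c t ω + pulls A t a ω * c := by
  have : (pulls A t a ω : ℝ) ≠ 0 := Nat.cast_ne_zero.2 h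
  rw [empMean, div_mul_cancel₀ _ this, sum_filter_eq_centredSum c]

/-- The capped sum follows the full sum until action `a` has been selected `n` times. -/
theorem centredSum_cappedSet_eq (c : ℝ) (h : pulls A t a ω ≤ n) :
    centredSum (cappedSet A a n) X c t ω = centredSum (selectedSet A a) X c t ω := by
  induction t with
  | zero => simp [centredSum]
  | succ t ih =>
    rw [centredSum_succ, centredSum_succ]
    by_cases ha : A (t + 1) ω = a
    · rw [pulls_succ_of_eq ha] at h
      have h1 : ω ∈ cappedSet A a n t := ⟨ha, h⟩
      have h2 : ω ∈ selectedSet A a t := ha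
      rw [ih (by omega), Set.indicator_of_mem h1, Set.indicator_of_mem h2]
    · rw [pulls_succ_of_ne ha] at h
      have h1 : ω ∉ cappedSet A a n t := fun h' => ha h'.1
      have h2 : ω ∉ selectedSet A a t := ha
      rw [ih h, Set.indicator_of_notMem h1, Set.indicator_of_notMem h2]

/-- The capped sum is frozen once action `a` has been selected `n` times. -/
theorem centredSum_cappedSet_of_le (c : ℝ) {T : ℕ} (hT : t ≤ T) (h : n ≤ pulls A t a ω) :
    centredSum (cappedSet A a n) X c T ω = centredSum (cappedSet A a n) X c t ω ∧
      n ≤ pulls A T a ω := by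
  induction T, hT using Nat.le_induction with
  | base => exact ⟨rfl, h⟩
  | succ T hT ih =>
    have h1 : ω ∉ cappedSet A a n T := fun h' => absurd h'.2 (not_lt.2 ih.2)
    rw [centredSum_succ, Set.indicator_of_notMem h1, add_zero]
    refine ⟨ih.1, ih.2.trans ?_⟩
    by_cases ha : A (T + 1) ω = a
    · rw [pulls_succ_of_eq ha]; omega
    · rw [pulls_succ_of_ne ha]

/-- The second bound feeds the induction for the first: a round is counted only while `pulls` is
below `n`, so the count, being at most `pulls`, cannot pass `n`. -/
theorem roundCount_cappedSet_le :
    roundCount (cappedSet A a n) t ω ≤ n ∧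
      roundCount (cappedSet A a n) t ω ≤ pulls A t a ω := by
  induction t with
  | zero => simp [roundCount]
  | succ t ih =>
    rw [roundCount_succ]
    by_cases h : ω ∈ cappedSet A a n t
    · rw [Set.indicator_of_mem h, pulls_succ_of_eq h.1]
      have h2 : ((pulls A t a ω : ℝ)) + 1 ≤ n := by exact_mod_cast h.2
      push_cast
      constructor <;> linarith [ih.2]
    · rw [Set.indicator_of_notMem h, add_zero]
      refine ⟨ih.1, ih.2.trans ?_⟩
      by_cases ha : A (t + 1) ω = a
      · rw [pulls_succ_of_eq ha]; push_cast; linarith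
      · rw [pulls_succ_of_ne ha]

/-- Multiplied by `n`, the radius becomes the Bernstein deviation of a sum, with `V = v n` and `L =
ln (1 / δ) = 2 ln T`. -/
theorem confRadius_mul {T : ℕ} (v : ℝ) (hn : n ≠ 0) :
    confRadius v (1 / (T : ℝ) ^ 2) n * n
      = Real.sqrt (2 * (v * n) * (2 * Real.log T)) + 2 * (2 * Real.log T) / 3 := by
  have hn' : (0 : ℝ) < n := by exact_mod_cast Nat.pos_of_ne_zero hn
  have hL : Real.log (1 / (1 / (T : ℝ) ^ 2)) = 2 * Real.log T := by
    rw [one_div_one_div, Real.log_pow]; norm_num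
  rw [confRadius, hL, add_mul]
  congr 1
  · have e : 2 * (v * n) * (2 * Real.log T) = 2 * v * (2 * Real.log T) / n * (n : ℝ) ^ 2 := by
      field_simp
    rw [e, Real.sqrt_mul' _ (sq_nonneg _), Real.sqrt_sq hn'.le]
  · field_simp

variable {T : ℕ} {μ σ : Fin K → ℝ} {star : Fin K}

/-- If action `a` wins against `star`, whose index does not underestimate its mean, then the
centred scores of `a` are large. -/
theorem le_centredSum_of_ucb
    (hucb : ucbIndex T σ A X t star ω ≤ ucbIndex T σ A X t a ω)
    (hgood : pulls A t star ω ≠ 0 → 0 ≤ centredSum (selectedSet A star) X (μ star) t ω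
      + (Real.sqrt (2 * (σ star ^ 2 * pulls A t star ω) * (2 * Real.log T))
        + 2 * (2 * Real.log T) / 3))
    (ha : pulls A t a ω ≠ 0) :
    (μ star - μ a) * pulls A t a ω
        - (Real.sqrt (2 * (σ a ^ 2 * pulls A t a ω) * (2 * Real.log T))
          + 2 * (2 * Real.log T) / 3)
      ≤ centredSum (selectedSet A a) X (μ a) t ω := by
  -- An unvisited `star` would have index `+∞` and beat the finite index of `a`.
  have hs : pulls A t star ω ≠ 0 := by
    intro h0
    rw [ucbIndex, ucbIndex, if_pos h0, if_neg ha] at hucb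
    exact absurd (top_le_iff.1 hucb) (EReal.coe_ne_top _)
  rw [ucbIndex, ucbIndex, if_neg hs, if_neg ha, EReal.coe_le_coe_iff] at hucb
  have hsp : (0 : ℝ) < pulls A t star ω := by exact_mod_cast Nat.pos_of_ne_zero hs
  have hap : (0 : ℝ) < pulls A t a ω := by exact_mod_cast Nat.pos_of_ne_zero ha
  have hstar : μ star ≤ empMean A X t star ω
      + confRadius (σ star ^ 2) (1 / (T : ℝ) ^ 2) (pulls A t star ω) := by
    refine le_of_mul_le_mul_right ?_ hsp
    rw [add_mul, empMean_mul_pulls (μ star) hs, confRadius_mul _ hs]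
    linarith [hgood hs]
  have := mul_le_mul_of_nonneg_right (hstar.trans hucb) hap.le
  rw [add_mul, empMean_mul_pulls (μ a) ha, confRadius_mul _ ha] at this
  linarith

/-- The bound on the number of selections of a suboptimal action on the event that the index of
the optimal action never underestimates its mean. -/
theorem pulls_le_of_good (hT : 1 ≤ T) (hgap : μ a < μ star)
    (hX : ∀ s < T, |X (s + 1) ω - μ a| ≤ 1)
    (hucb : ∀ s < T, ∀ b, ucbIndex T σ A X s b ω ≤ ucbIndex T σ A X s (A (s + 1) ω) ω)
    (hgood : ∀ s < T, pulls A s star ω ≠ 0 →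
      0 ≤ centredSum (selectedSet A star) X (μ star) s ω
      + (Real.sqrt (2 * (σ star ^ 2 * pulls A s star ω) * (2 * Real.log T))
        + 2 * (2 * Real.log T) / 3)) (ht : t ≤ T) :
    (μ star - μ a) * pulls A t a ω ≤ 2 * centredSum (selectedSet A a) X (μ a) t ω
      + ((μ star - μ a) + 4 * σ a ^ 2 * Real.log T / (μ star - μ a) + 8 * Real.log T / 3 + 2) := by
  have hD : 0 < μ star - μ a := sub_pos.2 hgap
  have hlog : 0 ≤ Real.log T := Real.log_nonneg (by exact_mod_cast hT)
  have hv : 0 ≤ 4 * σ a ^ 2 * Real.log T / (μ star - μ a) := by positivity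
  induction t with
  | zero => simp only [centredSum, pulls_zero]; simp; linarith
  | succ t ih =>
    rw [centredSum_succ]
    by_cases ha : A (t + 1) ω = a
    · have hm : ω ∈ selectedSet A a t := ha
      rw [pulls_succ_of_eq ha, Set.indicator_of_mem hm]
      have hY := neg_le_of_abs_le (hX t ht)
      -- On a selection of `a` the bound is proved directly, without the induction hypothesis. The
      -- terms `μ star - μ a` and `2` pay for the new selection and for its centred score, which is
      -- at least `-1`. A first selection needs nothing more.
      by_cases h0 : pulls A t a ω = 0
      · have hz : centredSum (selectedSet A a) X (μ a) t ω = 0 := by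
          rw [← centredSum_cappedSet_eq (n := 0) _ h0.le]
          exact Finset.sum_eq_zero fun s _ =>
            Set.indicator_of_notMem (fun h' => absurd h'.2 (Nat.not_lt_zero _)) _
        rw [hz, h0]
        push_cast
        linarith
      · have h1 := le_centredSum_of_ucb (ha ▸ hucb t ht star) (hgood t ht) h0
        set N : ℝ := (pulls A t a ω : ℝ)
        have hN : 0 ≤ N := Nat.cast_nonneg _
        -- AM-GM, with the product split so that exactly half of `(μ star - μ a) * N` is spent; the
        -- remaining half explains the factor 2 in front of the centred sum.
        have hsq : Real.sqrt (2 * (σ a ^ 2 * N) * (2 * Real.log T))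
            ≤ (μ star - μ a) * N / 2 + 2 * σ a ^ 2 * Real.log T / (μ star - μ a) := by
          refine Real.sqrt_le_iff.2 ⟨by positivity, ?_⟩
          have e : 2 * (σ a ^ 2 * N) * (2 * Real.log T) = 4 * ((μ star - μ a) * N / 2)
              * (2 * σ a ^ 2 * Real.log T / (μ star - μ a)) := by
            field_simp; ring
          rw [e]
          exact four_mul_le_sq_add _ _
        have e3 : 4 * σ a ^ 2 * Real.log T / (μ star - μ a)
            = 2 * (2 * σ a ^ 2 * Real.log T / (μ star - μ a)) := by ring
        push_cast
        rw [e3]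
        linarith
    · have hm : ω ∉ selectedSet A a t := ha
      rw [pulls_succ_of_ne ha, Set.indicator_of_notMem hm, add_zero]
      exact ih (by omega)

end Pathwise

/-! ### Expected number of selections and regret. -/

section Regret

variable {Ω : Type*} [mΩ : MeasurableSpace Ω] {P : Measure Ω}
  {ℱ : Filtration ℕ mΩ} {K T : ℕ} {A : ℕ → Ω → Fin K} {X θ : ℕ → Ω → ℝ} {μ σ : Fin K → ℝ}
  {star : Fin K}

namespace IsReflectionBandit

theorem measurableSet_selectedSet (h : IsReflectionBandit P ℱ T A X θ μ σ) (a : Fin K) {t : ℕ}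
    (ht : t < T) : MeasurableSet[ℱ t] (selectedSet A a t) :=
  h.action_predictable t ht (measurableSet_singleton a)

theorem measurable_pulls (h : IsReflectionBandit P ℱ T A X θ μ σ) (a : Fin K) {t : ℕ}
    (ht : t ≤ T) : Measurable[ℱ t] (pulls A t a) := by
  have e : pulls A t a
      = fun ω => ∑ s ∈ Finset.range t, (selectedSet A a s).indicator (fun _ => 1) ω := by
    clear ht
    funext ω
    induction t with
    | zero => simp [pulls]
    | succ t ih =>
      rw [Finset.sum_range_succ, ← ih]
      by_cases ha : A (t + 1) ω = a
      · rw [pulls_succ_of_eq ha, Set.indicator_of_mem (show ω ∈ selectedSet A a t from ha)]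
      · rw [pulls_succ_of_ne ha, Set.indicator_of_notMem (show ω ∉ selectedSet A a t from ha),
          add_zero]
  rw [e]
  refine Finset.measurable_fun_sum _ fun s hs => ?_
  have hst : s < t := Finset.mem_range.1 hs
  exact Measurable.indicator measurable_const
    (ℱ.mono hst.le _ (h.measurableSet_selectedSet a (by omega)))

theorem measurableSet_cappedSet (h : IsReflectionBandit P ℱ T A X θ μ σ) (a : Fin K) (n : ℕ)
    {t : ℕ} (ht : t < T) : MeasurableSet[ℱ t] (cappedSet A a n t) :=
  (h.measurableSet_selectedSet a ht).inter
    (h.measurable_pulls a ht.le (measurableSet_Iio (a := n)))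

variable [IsProbabilityMeasure P]

theorem integrable_pulls (h : IsReflectionBandit P ℱ T A X θ μ σ) (a : Fin K) :
    Integrable (fun ω => (pulls A T a ω : ℝ)) P := by
  refine Integrable.of_bound (measurable_from_top.comp
    ((h.measurable_pulls a le_rfl).mono (ℱ.le T) le_rfl)).aestronglyMeasurable (T : ℝ)
    (Filter.Eventually.of_forall fun ω => ?_)
  rw [Real.norm_natCast]
  exact Nat.cast_le.2 pulls_le

theorem gap_mul_integral_pulls_le_horizon (h : IsReflectionBandit P ℱ T A X θ μ σ) (a : Fin K)
    (hgap : μ a < μ star) :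
    (μ star - μ a) * ∫ ω, (pulls A T a ω : ℝ) ∂P ≤ (μ star - μ a) * T := by
  refine mul_le_mul_of_nonneg_left ?_ (sub_pos.2 hgap).le
  calc ∫ ω, (pulls A T a ω : ℝ) ∂P ≤ ∫ _, (T : ℝ) ∂P :=
        integral_mono (h.integrable_pulls a) (integrable_const _) fun ω => by
          exact Nat.cast_le.2 pulls_le
    _ = T := by simp

/-- The 5 is 2 from the pathwise bound plus 3 from failures of the index of `star`. The Bernstein
level `L = 2 ln T` must be positive, hence `2 ≤ T`. -/
theorem gap_mul_integral_pulls_le_log (h : IsReflectionBandit P ℱ T A X θ μ σ)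
    (hucb : SelectsByUCB P T σ A X) (hT : 2 ≤ T) (a : Fin K) (hgap : μ a < μ star) :
    (μ star - μ a) * ∫ ω, (pulls A T a ω : ℝ) ∂P ≤
      (μ star - μ a) + 4 * σ a ^ 2 * Real.log T / (μ star - μ a) + 8 * Real.log T / 3 + 5 := by
  have hT0 : (0 : ℝ) < T := by positivity
  have hlog : 0 < Real.log T := Real.log_pos (by exact_mod_cast hT)
  have hD : 0 < μ star - μ a := sub_pos.2 hgap
  have hD1 : μ star - μ a ≤ 1 := by linarith [(h.mean_mem star).2, (h.mean_mem a).1]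
  set D : ℝ := (μ star - μ a) + 4 * σ a ^ 2 * Real.log T / (μ star - μ a)
    + 8 * Real.log T / 3 + 2 with hDdef
  have hD0 : 0 ≤ D := by positivity
  set x : ℕ → ℝ := fun n => Real.sqrt (2 * (σ star ^ 2 * n) * (2 * Real.log T))
    + 2 * (2 * Real.log T) / 3 with hx
  have hdev : ∀ n : ℕ, ∃ l : ℝ, 0 ≤ l ∧
      Integrable (fun ω => Real.exp (-l *
        (centredSum (cappedSet A star n) X (μ star) T ω + x n))) P ∧
      ∫ ω, Real.exp (-l * (centredSum (cappedSet A star n) X (μ star) T ω + x n)) ∂P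
        ≤ Real.exp (-(2 * Real.log T)) := fun n =>
    h.integral_exp_deviation_le (fun t ht => h.measurableSet_cappedSet star n ht)
      (fun t _ ω hω => hω.1) (by positivity) fun ω => roundCount_cappedSet_le.1
  choose l hl0 hli hle using hdev
  have hSi : Integrable (centredSum (selectedSet A a) X (μ a) T) P :=
    h.integrable_centredSum (fun t ht => h.measurableSet_selectedSet a ht) a le_rfl
  have hS0 : ∫ ω, centredSum (selectedSet A a) X (μ a) T ω ∂P = 0 :=
    h.integral_centredSum (fun t ht => h.measurableSet_selectedSet a ht)
      (fun t _ ω hω => hω) le_rfl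
  have hucb' : ∀ᵐ ω ∂P, ∀ t < T, ∀ b,
      ucbIndex T σ A X t b ω ≤ ucbIndex T σ A X t (A (t + 1) ω) ω := by
    rw [ae_all_iff]
    intro t
    by_cases ht : t < T
    · filter_upwards [hucb t ht] with ω hω _ using hω
    · exact Filter.Eventually.of_forall fun ω h' => absurd h' ht
  -- The sum of exponentials dominates the indicator of the bad event, so Markov's inequality and
  -- the union bound are carried out pointwise, before integration.
  have hpt : ∀ᵐ ω ∂P, (μ star - μ a) * (pulls A T a ω : ℝ) ≤
      2 * centredSum (selectedSet A a) X (μ a) T ω + (D + 3 * T * ∑ n ∈ Finset.range T,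
        Real.exp (-l n * (centredSum (cappedSet A star n) X (μ star) T ω + x n))) := by
    filter_upwards [hucb', h.ae_abs_score_sub_le a,
      h.ae_abs_centredSum_le (G := selectedSet A a) a] with ω h1 h2 h3
    have hsum : 0 ≤ ∑ n ∈ Finset.range T,
        Real.exp (-l n * (centredSum (cappedSet A star n) X (μ star) T ω + x n)) :=
      Finset.sum_nonneg fun n _ => (Real.exp_pos _).le
    by_cases hgood : ∀ s < T, pulls A s star ω ≠ 0 →
        0 ≤ centredSum (selectedSet A star) X (μ star) s ω + x (pulls A s star ω)
    · have := pulls_le_of_good (by omega) hgap h2 h1 hgood le_rfl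
      have h3T : 0 ≤ 3 * (T : ℝ) := by positivity
      have := mul_nonneg h3T hsum
      linarith
    -- On the bad event the trivial bounds suffice: the gap is at most 1 and the centred sum at
    -- least `-T`, so the left side is at most `T ≤ 2 S + 3 T`.
    · push Not at hgood
      obtain ⟨s, hs, -, hneg⟩ := hgood
      set n := pulls A s star ω with hn
      have hnT : n ∈ Finset.range T := Finset.mem_range.2 (lt_of_le_of_lt pulls_le hs)
      -- The deviation at the random time `s` is that of the sum capped at `n = pulls A s star ω`,
      -- which no longer changes up to `T`; so one exponential per `n < T` is enough.
      rw [← centredSum_cappedSet_eq (n := n) _ hn.ge,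
        ← (centredSum_cappedSet_of_le _ hs.le hn.le).1] at hneg
      have hone : 1 ≤ ∑ n ∈ Finset.range T,
          Real.exp (-l n * (centredSum (cappedSet A star n) X (μ star) T ω + x n)) := by
        refine le_trans ?_ (Finset.single_le_sum (f := fun n =>
          Real.exp (-l n * (centredSum (cappedSet A star n) X (μ star) T ω + x n)))
          (fun n _ => (Real.exp_pos _).le) hnT)
        refine Real.one_le_exp ?_
        have := mul_nonneg_of_nonpos_of_nonpos (neg_nonpos.2 (hl0 n)) hneg.le
        exact this
      have h4 := neg_le_of_abs_le (h3 T le_rfl)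
      have h5 : (pulls A T a ω : ℝ) ≤ T := by exact Nat.cast_le.2 pulls_le
      have h6 := mul_le_mul hD1 h5 (Nat.cast_nonneg _) zero_le_one
      have h7 := mul_le_mul_of_nonneg_left hone (by positivity : 0 ≤ 3 * (T : ℝ))
      linarith
  have hsumi : Integrable (fun ω => ∑ n ∈ Finset.range T,
      Real.exp (-l n * (centredSum (cappedSet A star n) X (μ star) T ω + x n))) P :=
    integrable_finsetSum _ fun n _ => hli n
  have hexp : Real.exp (-(2 * Real.log T)) = 1 / (T : ℝ) ^ 2 := by
    rw [Real.exp_neg, two_mul, Real.exp_add, Real.exp_log hT0, one_div, sq]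
  have hsumle : ∫ ω, ∑ n ∈ Finset.range T,
      Real.exp (-l n * (centredSum (cappedSet A star n) X (μ star) T ω + x n)) ∂P ≤ 1 / (T : ℝ) := by
    rw [integral_finsetSum _ fun n _ => hli n]
    calc _ ≤ ∑ _n ∈ Finset.range T, 1 / (T : ℝ) ^ 2 :=
          Finset.sum_le_sum fun n _ => hexp ▸ hle n
      _ = 1 / (T : ℝ) := by rw [Finset.sum_const, Finset.card_range, nsmul_eq_mul]; field_simp
  have hrest : Integrable (fun ω => D + 3 * T * ∑ n ∈ Finset.range T,
      Real.exp (-l n * (centredSum (cappedSet A star n) X (μ star) T ω + x n))) P :=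
    (integrable_const D).add (hsumi.const_mul _)
  rw [← integral_const_mul]
  calc _ ≤ ∫ ω, (2 * centredSum (selectedSet A a) X (μ a) T ω
        + (D + 3 * T * ∑ n ∈ Finset.range T, Real.exp (-l n *
          (centredSum (cappedSet A star n) X (μ star) T ω + x n)))) ∂P :=
        integral_mono_ae ((h.integrable_pulls a).const_mul _)
          ((hSi.const_mul 2).add hrest) hpt
    _ = D + 3 * T * ∫ ω, ∑ n ∈ Finset.range T, Real.exp (-l n *
          (centredSum (cappedSet A star n) X (μ star) T ω + x n)) ∂P := by
        rw [integral_add (hSi.const_mul 2) hrest,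
          integral_add (integrable_const D) (hsumi.const_mul _), integral_const_mul,
          integral_const_mul, hS0]
        simp
    _ ≤ D + 3 * T * (1 / T) := by gcongr
    _ = _ := by rw [hDdef]; field_simp; ring

theorem gap_mul_integral_pulls_le (h : IsReflectionBandit P ℱ T A X θ μ σ)
    (hucb : SelectsByUCB P T σ A X) (hT : 1 ≤ T) (a : Fin K) (hgap : μ a < μ star) :
    (μ star - μ a) * ∫ ω, (pulls A T a ω : ℝ) ∂P ≤
      8 * σ a ^ 2 * Real.log T / (μ star - μ a) + 16 * Real.log T / 3
        + 2 * (μ star - μ a) := by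
  have hD : 0 < μ star - μ a := sub_pos.2 hgap
  have hD1 : μ star - μ a ≤ 1 := by linarith [(h.mean_mem star).2, (h.mean_mem a).1]
  have hlog : 0 ≤ Real.log T := Real.log_nonneg (by exact_mod_cast hT)
  have e : 8 * σ a ^ 2 * Real.log T / (μ star - μ a)
      = 2 * (4 * σ a ^ 2 * Real.log T / (μ star - μ a)) := by ring
  have hv : 0 ≤ 4 * σ a ^ 2 * Real.log T / (μ star - μ a) := by positivity
  rw [e]
  -- The logarithmic bound has to absorb 5 into the spare `8 ln T / 3`, which works once `ln T ≥ 2`.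
  -- For `T < 8` the bound by `(μ star - μ a) * T` is enough.
  rcases le_or_gt 8 T with h8 | h8
  · have hl8 : (2 : ℝ) ≤ Real.log T := by
      have : Real.log 8 ≤ Real.log T := Real.log_le_log (by norm_num) (by exact_mod_cast h8)
      have e8 : Real.log 8 = 3 * Real.log 2 := by
        rw [show (8 : ℝ) = 2 ^ 3 by norm_num, Real.log_pow]; norm_num
      linarith [Real.log_two_gt_d9]
    linarith [h.gap_mul_integral_pulls_le_log hucb (by omega) a hgap]
  -- For `T ≤ 2` the term `2 * (μ star - μ a)` already suffices. For `3 ≤ T ≤ 7` the left side is at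
  -- most 5, while `ln T ≥ 1` makes the right side at least `16 / 3`.
  · have hsmall : (μ star - μ a) * ((T : ℝ) - 2) ≤ 16 * Real.log T / 3 := by
      rcases le_or_gt T 2 with h2 | h2
      · have : (T : ℝ) ≤ 2 := by exact_mod_cast h2
        have := mul_nonpos_of_nonneg_of_nonpos hD.le (sub_nonpos.2 this)
        linarith
      · have h3 : (3 : ℝ) ≤ T := by exact_mod_cast h2
        have h7 : (T : ℝ) ≤ 7 := by exact_mod_cast Nat.lt_succ_iff.1 h8
        have hl3 : 1 ≤ Real.log T := by
          rw [Real.le_log_iff_exp_le (by linarith)]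
          linarith [Real.exp_one_lt_d9]
        have := mul_le_mul hD1 (show (T : ℝ) - 2 ≤ 5 by linarith) (by linarith) zero_le_one
        linarith
    linarith [h.gap_mul_integral_pulls_le_horizon a hgap]

end IsReflectionBandit

end Regret

theorem theorem1 {Ω : Type*} [mΩ : MeasurableSpace Ω] (P : Measure Ω) [IsProbabilityMeasure P]
    (ℱ : Filtration ℕ mΩ) {K : ℕ} (T : ℕ) (hT : 1 ≤ T)
    (A : ℕ → Ω → Fin K) (X θ : ℕ → Ω → ℝ) (μ σ : Fin K → ℝ) (star : Fin K)
    (hmodel : IsReflectionBandit P ℱ T A X θ μ σ)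
    (hucb : SelectsByUCB P T σ A X)
    (hstar : ∀ a, μ a ≤ μ star) :
    cumRegret P μ star A T ≤
      ∑ a ∈ Finset.univ.filter (fun a => μ a < μ star),
        (8 * σ a ^ 2 * Real.log T / (μ star - μ a) + 16 * Real.log T / 3
          + 2 * (μ star - μ a)) := by
  have e : cumRegret P μ star A T = ∑ a ∈ Finset.univ.filter (fun a => μ a < μ star),
      (μ star - μ a) * ∫ ω, (pulls A T a ω : ℝ) ∂P := by
    refine (Finset.sum_subset (fun a ha => ?_) fun a _ ha => ?_).symm
    · have : μ a < μ star := (Finset.mem_filter.1 ha).2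
      exact Finset.mem_erase.2 ⟨fun h => by simp [h] at this, Finset.mem_univ a⟩
    · have : ¬ μ a < μ star := fun h => ha (Finset.mem_filter.2 ⟨Finset.mem_univ a, h⟩)
      rw [le_antisymm (hstar a) (not_lt.1 this), sub_self, zero_mul]
  rw [e]
  exact Finset.sum_le_sum fun a ha =>
    hmodel.gap_mul_integral_pulls_le hucb hT a (Finset.mem_filter.1 ha).2
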